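/- Let $K$ be a field, let $G$ be a simple graph on $[n]=\{1,\ldots,n\}$, let $R=K[x_1,\ldots,x_n,y_1,\ldots,y_n]$, and let $\mathcal{J}_G=(x_iy_j-x_jy_i : \{i,j\}\in E(G))\subseteq R$ be the binomial edge ideal of $G$. Let $G_1,\ldots,G_c$ be the connected components of $G$, regarded as graphs on their own vertex sets. For a graph $H$ and a set $S$ of vertices of $H$, let $c_H(S)$ be the number of connected components of the graph $H\setminus S$. A connected graph $H$ is called $t$-tough if $t\cdot c_H(S)\leq |S|$ for every nonempty set $S$ of vertices of $H$ with $c_H(S)\geq 2$, and its toughness $\tau(H)$ is the largest $t$ for which $H$ is $t$-tough ($\tau(H)=\infty$ if $H$ is complete). If $R/\mathcal{J}_G$ is a Cohen–Macaulay ring, then for every $i=1,\ldots,c$, either $G_i$ is a complete graph or $\tau(G_i)=\frac{1}{2}$. -/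

import Mathlib

open scoped ENNReal NNReal

noncomputable section

namespace SimpleGraph

variable {V : Type*}

/-- `c(S)`: the number of connected components of the graph `G \ S`
obtained from `G` by deleting the vertices in `S`. -/
def numComponentsDelete (G : SimpleGraph V) (S : Finset V) : ℕ :=
  Nat.card (G.induce ((S : Set V)ᶜ)).ConnectedComponent

/-- A graph is `t`-tough if it is connected and `t * c(S) ≤ |S|` for every nonempty
set `S` of vertices with `c(S) ≥ 2`. -/
def IsTough (G : SimpleGraph V) (t : ℝ≥0) : Prop :=
  G.Connected ∧ ∀ S : Finset V, S.Nonempty → 2 ≤ G.numComponentsDelete S →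
    t * (G.numComponentsDelete S : ℝ≥0) ≤ (S.card : ℝ≥0)

/-- The toughness of `G`: the largest `t` for which `G` is `t`-tough, as an extended
nonnegative real number (it is `∞` for complete graphs). -/
def toughness (G : SimpleGraph V) : ℝ≥0∞ :=
  ⨆ (t : ℝ≥0) (_ : G.IsTough t), (t : ℝ≥0∞)

/-- The binomial edge ideal of `G` in `K[x_v, y_v : v ∈ V]`, where `x_v` is the variable
`X (Sum.inl v)` and `y_v` is the variable `X (Sum.inr v)`. -/
def binomialEdgeIdeal (K : Type*) [CommRing K] (G : SimpleGraph V) :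
    Ideal (MvPolynomial (V ⊕ V) K) :=
  Ideal.span {f | ∃ i j : V, G.Adj i j ∧
    f = MvPolynomial.X (Sum.inl i) * MvPolynomial.X (Sum.inr j) -
      MvPolynomial.X (Sum.inl j) * MvPolynomial.X (Sum.inr i)}

end SimpleGraph

/-- The depth of a (Noetherian) local ring `A`: the supremum of the lengths of `A`-regular
sequences contained in the maximal ideal. -/
def localRingDepth (A : Type*) [CommRing A] [IsLocalRing A] : ℕ∞ :=
  ⨆ (rs : List A) (_ : (∀ r ∈ rs, r ∈ IsLocalRing.maximalIdeal A) ∧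
    RingTheory.Sequence.IsRegular A rs), (rs.length : ℕ∞)

/-- A commutative ring `T` is Cohen–Macaulay if it is Noetherian and
`depth T_𝔭 = dim T_𝔭` for every prime ideal `𝔭`. -/
def IsCohenMacaulayRing (T : Type*) [CommRing T] : Prop :=
  IsNoetherianRing T ∧ ∀ (p : Ideal T) [p.IsPrime],
    ((localRingDepth (Localization.AtPrime p) : ℕ∞) : WithBot ℕ∞) =
      ringKrullDim (Localization.AtPrime p)

end

/-! For a set `S` of vertices in a component `C` with c(S) ≥ 2, localize R/J_G at the prime p where
the coordinates of `S` vanish and points in the same component of `G` are proportional. Two bounds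
on depth are played against explicit chains of primes below p. (1) Depth is at most dim A/P for
every minimal prime P. For the generic prime P (proportionality on components), Krull's height
theorem bounds this by |S|. Merging the c(S) pieces of C \ S one at a time gives a chain of length
c(S) - 1, so c(S) ≤ |S| + 1. (2) If `S` is a separator of least cardinality, only two minimal primes
lie below p: the generic one and the one attached to `S`. They meet only at p, so Hartshorne's
connectedness theorem gives depth ≤ 1. Killing the vertices of `S` one at a time gives a chain of
length |S|, so |S| ≤ 1. A non-complete component thus has a cut vertex leaving exactly two pieces,
so τ ≤ 1/2. Conversely c(T) ≤ |T| + 1 ≤ 2|T| for nonempty separating T gives τ ≥ 1/2. -/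

noncomputable section

/-! ### Upper bounds for depth in Noetherian local rings -/

open IsLocalRing RingTheory.Sequence Pointwise in
/-- The length of a regular sequence on `M` is at most the dimension of `A ⧸ P` for every
associated prime `P` of `M`. -/
theorem RingTheory.Sequence.IsRegular.length_le_coheight_of_isAssociatedPrime
    {A : Type*} [CommRing A] [IsLocalRing A] [IsNoetherianRing A] (rs : List A)
    (hrs : ∀ r ∈ rs, r ∈ maximalIdeal A) :
    ∀ {M : Type*} [AddCommGroup M] [Module A M] [Module.Finite A M], IsRegular M rs →
      ∀ P : PrimeSpectrum A, IsAssociatedPrime P.asIdeal M →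
        (rs.length : ℕ∞) ≤ Order.coheight P := by
  induction rs with
  | nil => intros; simp
  | cons r rs ih =>
    intro M _ _ _ hreg P hP
    rw [isRegular_cons_iff] at hreg
    obtain ⟨hr, hreg⟩ := hreg
    have hrm : r ∈ maximalIdeal A := hrs r (by simp)
    obtain ⟨-, z, hz⟩ := isAssociatedPrime_iff.1 hP
    have hz0 : z ≠ 0 := by
      rintro rfl
      exact P.2.ne_top (hz.trans (by simp))
    let N : Submodule A M :=
      { carrier := {w | ∀ a ∈ P.asIdeal, a • w = 0}
        add_mem' := fun hu hv a ha => by rw [smul_add, hu a ha, hv a ha, add_zero]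
        zero_mem' := fun a _ => smul_zero a
        smul_mem' := fun c w hw a ha => by rw [smul_comm, hw a ha, smul_zero] }
    have hzN : z ∈ N := fun a ha => by
      rw [hz, Submodule.mem_colon_singleton] at ha
      simpa using ha
    -- Otherwise N ⊆ rM; as r is regular on M this forces N = rN, and Nakayama gives N = 0. The
    -- class of w in M/rM is killed by P and r, so it yields an associated prime strictly above P.
    obtain ⟨w, hwN, hw⟩ : ∃ w ∈ N, w ∉ r • (⊤ : Submodule A M) := by
      by_contra! hcon
      have hN : N ≤ (Ideal.span {r}) • N := fun w hw => by
        obtain ⟨u, -, rfl⟩ := (Submodule.mem_smul_pointwise_iff_exists _ _ _).1 (hcon w hw)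
        refine Submodule.smul_mem_smul (Ideal.mem_span_singleton_self r) fun a ha => hr ?_
        have := hw a ha
        simpa [smul_comm a r] using this
      have := Submodule.eq_bot_of_le_smul_of_le_jacobson_bot _ N (IsNoetherian.noetherian N) hN
        (((Ideal.span_singleton_le_iff_mem _).2 hrm).trans (maximalIdeal_le_jacobson _))
      rw [this] at hzN
      exact hz0 (by simpa using hzN)
    let wb : QuotSMulTop r M := Submodule.Quotient.mk w
    have hwb : wb ≠ 0 := fun h => hw ((Submodule.Quotient.mk_eq_zero _).1 h)
    obtain ⟨Q, hQ, hle⟩ := exists_le_isAssociatedPrime_of_isNoetherianRing A wb hwb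
    have hPQ : P.asIdeal ≤ Q := fun a ha => hle <| by
      rw [Submodule.mem_colon_singleton]
      change a • wb = 0
      rw [← Submodule.Quotient.mk_smul, hwN a ha, Submodule.Quotient.mk_zero]
    have hrQ : r ∈ Q := hle <| by
      rw [Submodule.mem_colon_singleton]
      change r • wb = 0
      rw [← Submodule.Quotient.mk_smul]
      exact (Submodule.Quotient.mk_eq_zero _).2
        (Submodule.smul_mem_pointwise_smul _ _ _ Submodule.mem_top)
    have hrP : r ∉ P.asIdeal := fun h => hz0 <| hr <| by
      simpa using hzN r h
    have hlt : P < (⟨Q, hQ.isPrime⟩ : PrimeSpectrum A) :=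
      lt_of_le_of_ne hPQ fun h => hrP (by rw [h]; exact hrQ)
    have := ih (fun a ha => hrs a (by simp [ha])) hreg ⟨Q, hQ.isPrime⟩ hQ
    calc ((r :: rs).length : ℕ∞) = rs.length + 1 := by simp
      _ ≤ Order.coheight (⟨Q, hQ.isPrime⟩ : PrimeSpectrum A) + 1 := by gcongr
      _ ≤ _ := Order.coheight_add_one_le hlt

-- Minimal primes of `A` are associated primes of the module `A`.
open IsLocalRing in
theorem localRingDepth_le_coheight_of_mem_minimalPrimes
    {A : Type*} [CommRing A] [IsLocalRing A] [IsNoetherianRing A] (P : PrimeSpectrum A)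
    (hP : P.asIdeal ∈ minimalPrimes A) : localRingDepth A ≤ Order.coheight P := by
  refine iSup₂_le fun rs hrs => ?_
  refine hrs.2.length_le_coheight_of_isAssociatedPrime rs hrs.1 P ?_
  refine Module.associatedPrimes.minimalPrimes_annihilator_subset_associatedPrimes A A ?_
  rw [(Module.annihilator_eq_bot).2 inferInstance]
  exact hP

open IsLocalRing in
/-- Krull's height theorem for `A ⧸ P`, with `A` local. -/
theorem IsLocalRing.coheight_le_card_of_maximalIdeal_mem_minimalPrimes
    {A : Type*} [CommRing A] [IsLocalRing A] [IsNoetherianRing A] (P : PrimeSpectrum A)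
    (s : Finset A) (hs : maximalIdeal A ∈ (P.asIdeal ⊔ Ideal.span (s : Set A)).minimalPrimes) :
    Order.coheight P ≤ s.card := by
  classical
  have : Nontrivial (A ⧸ P.asIdeal) := Ideal.Quotient.nontrivial_iff.2 P.2.ne_top
  have : IsLocalRing (A ⧸ P.asIdeal) :=
    .of_surjective' _ Ideal.Quotient.mk_surjective
  have : IsLocalHom (Ideal.Quotient.mk P.asIdeal) :=
    .of_surjective _ Ideal.Quotient.mk_surjective
  have hdim : (Order.coheight P : WithBot ℕ∞) = ringKrullDim (A ⧸ P.asIdeal) := by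
    rw [Order.coheight_eq_krullDim_Ici, ringKrullDim_quotient]
    rfl
  have hmin : maximalIdeal (A ⧸ P.asIdeal) ∈ (Ideal.span
      ((s.image (Ideal.Quotient.mk P.asIdeal) : Finset _) : Set (A ⧸ P.asIdeal))).minimalPrimes := by
    refine ⟨⟨inferInstance, ?_⟩, ?_⟩
    · rw [Ideal.span_le]
      intro x hx
      obtain ⟨y, hy, rfl⟩ := Finset.mem_image.1 (Finset.mem_coe.1 hx)
      exact map_nonunit _ _ (hs.1.2 (Ideal.mem_sup_right (Ideal.subset_span hy)))
    · rintro Q ⟨hQ, hsQ⟩ -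
      have hle : maximalIdeal A ≤ Q.comap (Ideal.Quotient.mk P.asIdeal) := by
        refine hs.2 ⟨hQ.comap _, sup_le (fun x hx => ?_) ?_⟩
          (le_maximalIdeal (hQ.comap _).ne_top)
        · rw [Ideal.mem_comap, Ideal.Quotient.eq_zero_iff_mem.2 hx]
          exact Q.zero_mem
        · rw [Ideal.span_le]
          exact fun x hx => hsQ (Ideal.subset_span (by
            simpa using ⟨x, hx, rfl⟩))
      intro x hx
      obtain ⟨y, rfl⟩ := Ideal.Quotient.mk_surjective x
      exact hle ((mem_maximalIdeal _).2 fun hy => (mem_maximalIdeal _).1 hx (hy.map _))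
  have hcard := Ideal.height_le_card_of_mem_minimalPrimes_span_finset hmin
  have h2 : (Order.coheight P : WithBot ℕ∞) ≤ ((s.card : ℕ∞) : WithBot ℕ∞) := by
    rw [hdim, ← maximalIdeal_height_eq_ringKrullDim]
    exact WithBot.coe_le_coe.2 (hcard.trans (by exact_mod_cast Finset.card_image_le))
  exact WithBot.coe_le_coe.1 h2

/-- Hartshorne's connectedness argument for a regular sequence of length two. -/
theorem IsLocalRing.eq_zero_or_of_add_mul_eq_zero
    {A : Type*} [CommRing A] [IsLocalRing A] {a b u v u' v' : A}
    (ha : IsSMulRegular A a) (hb : ∀ r, a ∣ b * r → a ∣ r)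
    (huv : a = u + v) (huv' : b = u' + v') (h1 : u * v = 0) (h2 : u * v' = 0)
    (h3 : u' * v = 0)  : u = 0 ∨ v = 0 := by
  -- Both sides equal u * u'. Regularity then gives u = a * w and v = a * (1 - w) with w * (1 - w) =
  -- 0, and locality makes one factor a unit.
  have key : a * u' = b * u := by
    rw [huv, huv']; linear_combination h3 - h2
  obtain ⟨w, hw⟩ := hb u ⟨u', key.symm⟩
  have hv : v = a * (1 - w) := by linear_combination -huv - hw
  have hww : w * (1 - w) = 0 := by
    refine ha (ha ?_)
    simp only [smul_eq_mul, mul_zero]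
    rw [hw, hv] at h1
    linear_combination h1
  rcases IsLocalRing.isUnit_or_isUnit_of_add_one (a := w) (b := 1 - w) (by ring) with h | h
  · right
    rw [hv, h.mul_right_eq_zero.1 hww, mul_zero]
  · left
    rw [hw, h.mul_left_eq_zero.1 hww, mul_zero]

/-- Regularity of the pair a, b passes to powers. This is needed because in Hartshorne's argument
only powers of a and b split as sums. -/
theorem dvd_of_pow_dvd_pow_mul {A : Type*} [CommRing A] {a b : A}
    (ha : IsSMulRegular A a) (hb : ∀ r, a ∣ b * r → a ∣ r) (m n : ℕ) :
    ∀ r, a ^ m ∣ b ^ n * r → a ^ m ∣ r := by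
  have hb' : ∀ n r, a ∣ b ^ n * r → a ∣ r := by
    intro n
    induction n with
    | zero => simp
    | succ n ih =>
      intro r hr
      exact hb r (ih _ (by rwa [← mul_assoc, ← pow_succ]))
  induction m with
  | zero => simp
  | succ m ih =>
    intro r hr
    obtain ⟨s, rfl⟩ := hb' n r ((dvd_pow_self a (by omega)).trans hr)
    obtain ⟨c, hc⟩ := hr
    have : b ^ n * s = a ^ m * c := ha (by simp only [smul_eq_mul]; linear_combination hc)
    obtain ⟨d, hd⟩ := ih s ⟨c, this⟩
    exact ⟨d, by rw [hd]; ring⟩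

open IsLocalRing RingTheory.Sequence in
/-- A special case of Hartshorne's connectedness theorem: a Noetherian local ring whose spectrum is
the union of two irreducible components meeting only in the closed point has depth at most one. -/
theorem localRingDepth_le_one_of_minimalPrimes
    {A : Type*} [CommRing A] [IsLocalRing A] [IsNoetherianRing A] {I L : Ideal A}
    (hI : I ∈ minimalPrimes A) (hL : L ∈ minimalPrimes A)
    (hor : ∀ Q : Ideal A, Q.IsPrime → I ≤ Q ∨ L ≤ Q)
    (hand : ∀ Q : Ideal A, Q.IsPrime → I ≤ Q → L ≤ Q → Q = maximalIdeal A) :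
    localRingDepth A ≤ 1 := by
  refine iSup₂_le fun rs hrs => ?_
  obtain ⟨hm, hreg⟩ := hrs
  match rs, hm, hreg with
  | [], _, _ => simp
  | [_], _, _ => simp
  | a :: b :: rs, hm, hreg =>
    exfalso
    rw [isRegular_cons_iff, isRegular_cons_iff] at hreg
    obtain ⟨ha, hb, -⟩ := hreg
    have hb' : ∀ r, a ∣ b * r → a ∣ r := by
      rintro r ⟨c, hc⟩
      have h0 : ∀ x : A, (Submodule.Quotient.mk x : QuotSMulTop a A) = 0 ↔ a ∣ x := fun x => by
        rw [Submodule.Quotient.mk_eq_zero, Submodule.mem_smul_pointwise_iff_exists]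
        exact ⟨fun ⟨y, _, hy⟩ => ⟨y, hy.symm⟩, fun ⟨y, hy⟩ => ⟨y, Submodule.mem_top, hy.symm⟩⟩
      refine (h0 r).1 (hb ?_)
      simp only [smul_zero]
      rw [← Submodule.Quotient.mk_smul]
      exact (h0 _).2 ⟨c, hc⟩
    obtain ⟨k, hk⟩ : ∃ k, (I * L) ^ k ≤ (⊥ : Ideal A) := by
      refine Ideal.exists_pow_le_of_le_radical_of_fg ?_ (IsNoetherian.noetherian _)
      rw [Ideal.radical_eq_sInf]
      refine le_sInf fun Q hQ => ?_
      rcases hor Q hQ.2 with h | h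
      · exact Ideal.mul_le_left.trans h
      · exact Ideal.mul_le_right.trans h
    -- The exponent k + 1 is nonzero even if k = 0, so these powers stay inside I and L.
    have hk1 : I ^ (k + 1) * L ^ (k + 1) = ⊥ := by
      rw [← mul_pow]
      exact le_bot_iff.1 ((Ideal.pow_le_pow_right (Nat.le_succ k)).trans hk)
    have hrad : maximalIdeal A ≤ (I ^ (k + 1) ⊔ L ^ (k + 1)).radical := by
      rw [Ideal.radical_eq_sInf]
      refine le_sInf fun Q hQ => ?_
      have := hQ.2
      rw [hand Q hQ.2 (this.le_of_pow_le (le_sup_left.trans hQ.1))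
        (this.le_of_pow_le (le_sup_right.trans hQ.1))]
    obtain ⟨m, hma⟩ := hrad (hm a (by simp))
    obtain ⟨n, hnb⟩ := hrad (hm b (by simp))
    obtain ⟨u, hu, v, hv, huv⟩ := Submodule.mem_sup.1 hma
    obtain ⟨u', hu', v', hv', huv'⟩ := Submodule.mem_sup.1 hnb
    have hzero : ∀ x ∈ I ^ (k + 1), ∀ y ∈ L ^ (k + 1), x * y = 0 := fun x hx y hy => by
      have := Ideal.mul_mem_mul hx hy
      rwa [hk1, Ideal.mem_bot] at this
    rcases eq_zero_or_of_add_mul_eq_zero (ha.pow m) (dvd_of_pow_dvd_pow_mul ha hb' m n)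
      huv.symm huv'.symm (hzero u hu v hv) (hzero u hu v' hv') (hzero u' hu' v hv) with h | h
    -- If u = 0 then a ^ m = v lies in L, but a regular element avoids minimal primes.
    · refine ha.notMem_of_mem_minimalPrimes (p := L) ?_ ?_
      · rwa [(Module.annihilator_eq_bot).2 inferInstance]
      · refine hL.1.1.mem_of_pow_mem m (Ideal.pow_le_self k.succ_ne_zero ?_)
        rwa [← huv, h, zero_add]
    · refine ha.notMem_of_mem_minimalPrimes (p := I) ?_ ?_
      · rwa [(Module.annihilator_eq_bot).2 inferInstance]
      · refine hI.1.1.mem_of_pow_mem m (Ideal.pow_le_self k.succ_ne_zero ?_)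
        rwa [← huv, h, add_zero]

/-! ### Chains of primes in Cohen–Macaulay quotients -/

open IsLocalRing in
/-- Localizing `R ⧸ J` at a prime `p ⊇ J`: the primes are those of `R` between `J` and `p`. -/
theorem IsCohenMacaulayRing.exists_local.{u} {R : Type u} [CommRing R] {J : Ideal R}
    (hCM : IsCohenMacaulayRing (R ⧸ J)) (p : Ideal R) [p.IsPrime] (hJp : J ≤ p) :
    ∃ (B : Type u) (_ : CommRing B) (_ : IsLocalRing B) (_ : IsNoetherianRing B) (f : R →+* B),
      (∀ Q : Ideal B, J ≤ Q.comap f) ∧ (∀ Q Q' : Ideal B, Q.comap f ≤ Q'.comap f → Q ≤ Q') ∧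
      (∀ q : Ideal R, q.IsPrime → J ≤ q → q ≤ p → ∃ Q : Ideal B, Q.IsPrime ∧ Q.comap f = q) ∧
      (maximalIdeal B).comap f = p ∧
      ((localRingDepth B : ℕ∞) : WithBot ℕ∞) = ringKrullDim B := by
  obtain ⟨hN, hdepth⟩ := hCM
  have hcm : ∀ q : Ideal R, J ≤ q → (q.map (Ideal.Quotient.mk J)).comap (Ideal.Quotient.mk J) = q :=
    fun q hq => by
      rw [Ideal.comap_map_of_surjective _ Ideal.Quotient.mk_surjective, ← RingHom.ker_eq_comap_bot,
        Ideal.mk_ker, sup_eq_left.2 hq]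
  let pb := p.map (Ideal.Quotient.mk J)
  have hpb : pb.IsPrime := Ideal.map_isPrime_of_surjective Ideal.Quotient.mk_surjective
    (by rwa [Ideal.mk_ker])
  refine ⟨Localization.AtPrime pb, inferInstance, inferInstance,
    IsLocalization.isNoetherianRing pb.primeCompl _ hN,
    (algebraMap (R ⧸ J) (Localization.AtPrime pb)).comp (Ideal.Quotient.mk J), ?_, ?_, ?_, ?_,
    hdepth pb⟩
  · intro Q x hx
    rw [Ideal.mem_comap, RingHom.comp_apply, Ideal.Quotient.eq_zero_iff_mem.2 hx, map_zero]
    exact Q.zero_mem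
  · intro Q Q' h
    rw [← Ideal.comap_comap, ← Ideal.comap_comap,
      Ideal.comap_le_comap_iff_of_surjective _ Ideal.Quotient.mk_surjective] at h
    exact (IsLocalization.orderEmbedding pb.primeCompl (Localization.AtPrime pb)).le_iff_le.1 h
  · intro q hq hJq hqp
    let qb := q.map (Ideal.Quotient.mk J)
    have hqb : qb.IsPrime := Ideal.map_isPrime_of_surjective Ideal.Quotient.mk_surjective
      (by rwa [Ideal.mk_ker])
    have hle : qb ≤ pb := Ideal.map_mono hqp
    refine ⟨qb.map (algebraMap (R ⧸ J) (Localization.AtPrime pb)),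
      Ideal.isPrime_map_of_isLocalizationAtPrime pb hle, ?_⟩
    rw [← Ideal.comap_comap]
    have := Ideal.under_map_of_isLocalizationAtPrime (S := Localization.AtPrime pb) pb hle
    rw [Ideal.under_def] at this
    rw [this, hcm q hJq]
  · rw [← Ideal.comap_comap]
    have := Localization.AtPrime.under_maximalIdeal (I := pb)
    rw [Ideal.under_def] at this
    rw [this, hcm p hJp]

open IsLocalRing in
theorem natCast_le_ringKrullDim_of_comap {R B : Type*} [CommRing R] [CommRing B] [IsLocalRing B]
    {J : Ideal R} (f : R →+* B) (hmono : ∀ Q Q' : Ideal B, Q.comap f ≤ Q'.comap f → Q ≤ Q')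
    (hex : ∀ q : Ideal R, q.IsPrime → J ≤ q → q ≤ (maximalIdeal B).comap f →
      ∃ Q : Ideal B, Q.IsPrime ∧ Q.comap f = q)
    (d : ℕ) (l : ℕ → Ideal R) (hl : ∀ m ≤ d, (l m).IsPrime) (hJ : ∀ m ≤ d, J ≤ l m)
    (hp : ∀ m ≤ d, l m ≤ (maximalIdeal B).comap f) (hlt : ∀ m < d, l m < l (m + 1)) :
    (d : WithBot ℕ∞) ≤ ringKrullDim B := by
  choose Q hQ hQl using fun i : Fin (d + 1) =>
    hex (l i) (hl i (by omega)) (hJ i (by omega)) (hp i (by omega))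
  let s : LTSeries (PrimeSpectrum B) :=
    { length := d
      toFun := fun i => ⟨Q i, hQ i⟩
      step := fun i => by
        have h := hlt i i.2
        refine lt_of_le_not_ge (hmono _ _ ?_) fun hle => h.not_ge ?_
        · rw [hQl, hQl]; simpa using h.le
        · have := Ideal.comap_mono (f := f) hle
          change (Q i.succ).comap f ≤ (Q i.castSucc).comap f at this
          rw [hQl, hQl] at this
          simpa using this }
  exact Order.LTSeries.length_le_krullDim s

theorem mem_minimalPrimes_of_comap {R B : Type*} [CommRing R] [CommRing B]
    {J : Ideal R} (f : R →+* B) (hJ : ∀ Q : Ideal B, J ≤ Q.comap f)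
    (hmono : ∀ Q Q' : Ideal B, Q.comap f ≤ Q'.comap f → Q ≤ Q')
    {Q : Ideal B} (hQ : Q.IsPrime) (h : Q.comap f ∈ J.minimalPrimes) : Q ∈ minimalPrimes B := by
  refine ⟨⟨hQ, bot_le⟩, fun Q' hQ' hle => hmono _ _ ?_⟩
  have := hQ'.1
  exact h.2 ⟨Ideal.comap_isPrime f Q', hJ Q'⟩ (Ideal.comap_mono hle)

/-- If `R ⧸ J` is Cohen–Macaulay and `p` is minimal over `P + (s)` with `P` a minimal prime of `J`,
then chains of primes between `J` and `p` have length at most `|s|`. -/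
theorem IsCohenMacaulayRing.chain_length_le_card {R : Type*} [CommRing R] {J : Ideal R}
    (hCM : IsCohenMacaulayRing (R ⧸ J)) {P p : Ideal R} (hP : P ∈ J.minimalPrimes) (s : Finset R)
    (hp : p ∈ (P ⊔ Ideal.span (s : Set R)).minimalPrimes)
    (d : ℕ) (l : ℕ → Ideal R) (hl : ∀ m ≤ d, (l m).IsPrime) (hJ : ∀ m ≤ d, J ≤ l m)
    (hlp : ∀ m ≤ d, l m ≤ p) (hlt : ∀ m < d, l m < l (m + 1)) : d ≤ s.card := by
  classical
  have hpp : p.IsPrime := hp.1.1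
  have hPp : P ≤ p := le_sup_left.trans hp.1.2
  obtain ⟨B, _, _, _, f, hJB, hmono, hex, hmax, hdepth⟩ := hCM.exists_local p (hP.1.2.trans hPp)
  have h1 := natCast_le_ringKrullDim_of_comap f hmono (by rwa [hmax]) d l hl hJ (by rwa [hmax]) hlt
  obtain ⟨Q, hQ, hQP⟩ := hex P hP.1.1 hP.1.2 hPp
  have h2 := localRingDepth_le_coheight_of_mem_minimalPrimes ⟨Q, hQ⟩
    (mem_minimalPrimes_of_comap f hJB hmono hQ (by rwa [hQP]))
  have h3 := IsLocalRing.coheight_le_card_of_maximalIdeal_mem_minimalPrimes ⟨Q, hQ⟩ (s.image f) (by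
    refine ⟨⟨inferInstance, ?_⟩, fun Q' hQ' _ => hmono _ _ ?_⟩
    · refine IsLocalRing.le_maximalIdeal fun htop => ?_
      have hle : Q ⊔ Ideal.span ((s.image f : Finset B) : Set B) ≤ IsLocalRing.maximalIdeal B := by
        refine sup_le (IsLocalRing.le_maximalIdeal hQ.ne_top) (Ideal.span_le.2 fun x hx => ?_)
        obtain ⟨y, hy, rfl⟩ := Finset.mem_image.1 (Finset.mem_coe.1 hx)
        have : y ∈ (IsLocalRing.maximalIdeal B).comap f := by
          rw [hmax]
          exact hp.1.2 (Ideal.mem_sup_right (Ideal.subset_span hy))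
        exact this
      change Q ⊔ _ = ⊤ at htop
      rw [htop] at hle
      exact Ideal.IsPrime.ne_top' (top_le_iff.1 hle)
    · have := hQ'.1
      have hle : Q ≤ Q' := le_sup_left.trans hQ'.2
      have hQ'p : Q'.comap f ≤ p := hmax ▸ Ideal.comap_mono (IsLocalRing.le_maximalIdeal this.ne_top)
      rw [hmax]
      refine hp.2 ⟨Ideal.comap_isPrime f Q', sup_le ?_ (Ideal.span_le.2 fun x hx => ?_)⟩ hQ'p
      · exact hQP ▸ Ideal.comap_mono hle
      · exact hQ'.2 (Ideal.mem_sup_right (Ideal.subset_span (by simpa using ⟨x, hx, rfl⟩))))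
  rw [← hdepth] at h1
  have h4 : ((d : ℕ∞)) ≤ localRingDepth B := WithBot.coe_le_coe.1 (by exact_mod_cast h1)
  have h5 := (h4.trans (h2.trans h3))
  exact (by exact_mod_cast h5 : d ≤ (s.image f).card).trans Finset.card_image_le

/-- If `R ⧸ J` is Cohen–Macaulay and only two minimal primes of `J` lie in `p`, meeting only at `p`,
then chains of primes between `J` and `p` have length at most one. -/
theorem IsCohenMacaulayRing.chain_length_le_one {R : Type*} [CommRing R] {J : Ideal R}
    (hCM : IsCohenMacaulayRing (R ⧸ J)) {P P' p : Ideal R} [p.IsPrime] (hP : P ∈ J.minimalPrimes)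
    (hP' : P' ∈ J.minimalPrimes) (hPp : P ≤ p) (hPp' : P' ≤ p)
    (hor : ∀ q : Ideal R, q.IsPrime → J ≤ q → q ≤ p → P ≤ q ∨ P' ≤ q)
    (hand : ∀ q : Ideal R, q.IsPrime → q ≤ p → P ≤ q → P' ≤ q → p ≤ q)
    (d : ℕ) (l : ℕ → Ideal R) (hl : ∀ m ≤ d, (l m).IsPrime) (hJ : ∀ m ≤ d, J ≤ l m)
    (hlp : ∀ m ≤ d, l m ≤ p) (hlt : ∀ m < d, l m < l (m + 1)) : d ≤ 1 := by
  obtain ⟨B, _, _, _, f, hJB, hmono, hex, hmax, hdepth⟩ := hCM.exists_local p (hP.1.2.trans hPp)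
  have h1 := natCast_le_ringKrullDim_of_comap f hmono (by rwa [hmax]) d l hl hJ (by rwa [hmax]) hlt
  obtain ⟨Q, hQ, hQP⟩ := hex P hP.1.1 hP.1.2 hPp
  obtain ⟨Q', hQ', hQP'⟩ := hex P' hP'.1.1 hP'.1.2 hPp'
  have hle : ∀ N : Ideal B, N.IsPrime → N.comap f ≤ p := fun N hN =>
    hmax ▸ Ideal.comap_mono (IsLocalRing.le_maximalIdeal hN.ne_top)
  have h2 := localRingDepth_le_one_of_minimalPrimes
    (mem_minimalPrimes_of_comap f hJB hmono hQ (by rwa [hQP]))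
    (mem_minimalPrimes_of_comap f hJB hmono hQ' (by rwa [hQP']))
    (fun N hN => by
      rcases hor (N.comap f) (hN.comap f) (hJB N) (hle N hN) with h | h
      · exact Or.inl (hmono _ _ (hQP.trans_le h))
      · exact Or.inr (hmono _ _ (hQP'.trans_le h)))
    (fun N hN h h' => le_antisymm (IsLocalRing.le_maximalIdeal hN.ne_top) <| hmono _ _ <| by
      rw [hmax]
      exact hand _ (hN.comap f) (hle N hN) (hQP.symm.trans_le (Ideal.comap_mono h))
        (hQP'.symm.trans_le (Ideal.comap_mono h')))
  rw [← hdepth] at h1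
  have h4 : ((d : ℕ∞)) ≤ localRingDepth B := WithBot.coe_le_coe.1 (by exact_mod_cast h1)
  exact_mod_cast h4.trans h2

/-! ### Prime ideals of colored vertex sets -/

namespace SimpleGraph

open MvPolynomial

variable {K : Type*} [Field K] {V W : Type*}

open Classical in
/-- The parametrization `x_i ↦ x_i`, `y_i ↦ x_i t_{c i}` for `i ∉ S`, and `x_i, y_i ↦ 0` for
`i ∈ S`. -/
def coloredHom (K : Type*) [Field K] (S : Set V) (c : V → W) :
    MvPolynomial (V ⊕ V) K →ₐ[K] MvPolynomial (V ⊕ W) K :=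
  aeval (Sum.elim (fun i => if i ∈ S then 0 else X (Sum.inl i))
    (fun i => if i ∈ S then 0 else X (Sum.inl i) * X (Sum.inr (c i))))

/-- The prime ideal of the variety where all coordinates indexed by `S` vanish and points
`(x_i, y_i)`, `(x_j, y_j)` of the same color are proportional. -/
def coloredIdeal (K : Type*) [Field K] (S : Set V) (c : V → W) : Ideal (MvPolynomial (V ⊕ V) K) :=
  RingHom.ker (coloredHom K S c)

/-- The `2`-minor of the generic matrix on columns `i` and `j`. -/
def edgeBinomial (K : Type*) [CommRing K] (i j : V) : MvPolynomial (V ⊕ V) K :=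
  X (Sum.inl i) * X (Sum.inr j) - X (Sum.inl j) * X (Sum.inr i)

/-- Defining the ideal as the kernel of a map into a domain makes primality immediate, with no need
for generators. -/
instance coloredIdeal_isPrime (S : Set V) (c : V → W) : (coloredIdeal K S c).IsPrime :=
  RingHom.ker_isPrime _

theorem X_inl_mem_coloredIdeal {S : Set V} {c : V → W} {i : V} :
    X (Sum.inl i) ∈ coloredIdeal K S c ↔ i ∈ S := by
  rw [coloredIdeal, RingHom.mem_ker, coloredHom, aeval_X]
  by_cases h : i ∈ S <;> simp [h, X_ne_zero]

theorem X_inr_mem_coloredIdeal {S : Set V} {c : V → W} {i : V} :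
    X (Sum.inr i) ∈ coloredIdeal K S c ↔ i ∈ S := by
  rw [coloredIdeal, RingHom.mem_ker, coloredHom, aeval_X]
  by_cases h : i ∈ S <;> simp [h, X_ne_zero]

theorem edgeBinomial_mem_coloredIdeal {S : Set V} {c : V → W} {i j : V} :
    edgeBinomial K i j ∈ coloredIdeal K S c ↔ (i ∉ S → j ∉ S → c i = c j) := by
  rw [coloredIdeal, RingHom.mem_ker, coloredHom, edgeBinomial, map_sub, map_mul, map_mul, aeval_X,
    aeval_X, aeval_X, aeval_X]
  by_cases hi : i ∈ S
  · simp [hi]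
  by_cases hj : j ∈ S
  · simp [hj]
  simp only [Sum.elim_inl, Sum.elim_inr, hi, hj, if_false, not_false_eq_true, forall_const]
  have : (X (Sum.inl i) * (X (Sum.inl j) * X (Sum.inr (c j))) -
      X (Sum.inl j) * (X (Sum.inl i) * X (Sum.inr (c i))) : MvPolynomial (V ⊕ W) K) =
      X (Sum.inl i) * X (Sum.inl j) * (X (Sum.inr (c j)) - X (Sum.inr (c i))) := by ring
  rw [this, mul_eq_zero, mul_eq_zero, sub_eq_zero]
  simp only [X_ne_zero, false_or]
  exact ⟨fun h => (Sum.inr_injective (X_injective h)).symm, fun h => by rw [h]⟩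

theorem coloredIdeal_le_ker {L : Type*} [CommRing L] [Algebra K L] {S : Set V} {c : V → W}
    (g : MvPolynomial (V ⊕ V) K →ₐ[K] L) (t : W → L) (hx : ∀ i ∈ S, g (X (Sum.inl i)) = 0)
    (hy : ∀ i, g (X (Sum.inr i)) = g (X (Sum.inl i)) * t (c i)) :
    coloredIdeal K S c ≤ RingHom.ker g := by
  have h : g = (aeval (Sum.elim (fun i => g (X (Sum.inl i))) t)).comp (coloredHom K S c) := by
    refine algHom_ext fun i => ?_
    rw [AlgHom.comp_apply, coloredHom, aeval_X]
    rcases i with i | i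
    · by_cases hi : i ∈ S <;> simp [hi, hx]
    · by_cases hi : i ∈ S <;> simp [hi, hx, hy]
  intro f hf
  rw [RingHom.mem_ker, h, AlgHom.comp_apply, (RingHom.mem_ker.1 hf : coloredHom K S c f = 0),
    map_zero]

/-- Over the fraction field of the quotient by q, every point (x_i, y_i) is x_i times a slope
depending only on the color, so the quotient map factors through the parametrization. -/
theorem coloredIdeal_le_of_isPrime {S : Set V} {c : V → W} {q : Ideal (MvPolynomial (V ⊕ V) K)}
    [q.IsPrime] (hS : ∀ i ∈ S, X (Sum.inl i) ∈ q)
    (hxy : ∀ i, X (Sum.inl i) ∈ q → X (Sum.inr i) ∈ q)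
    (h : ∀ i j, X (Sum.inl i) ∉ q → X (Sum.inl j) ∉ q → c i = c j → edgeBinomial K i j ∈ q) :
    coloredIdeal K S c ≤ q := by
  classical
  let L := FractionRing (MvPolynomial (V ⊕ V) K ⧸ q)
  let g : MvPolynomial (V ⊕ V) K →ₐ[K] L :=
    (IsScalarTower.toAlgHom K (MvPolynomial (V ⊕ V) K ⧸ q) L).comp (Ideal.Quotient.mkₐ K q)
  have hg : ∀ f, g f = 0 ↔ f ∈ q := fun f => by
    change algebraMap (MvPolynomial (V ⊕ V) K ⧸ q) L (Ideal.Quotient.mk q f) = 0 ↔ _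
    rw [FaithfulSMul.algebraMap_eq_zero_iff, Ideal.Quotient.eq_zero_iff_mem]
  -- The slope y/x of any vertex of color w with x ∉ q. If there is none, all such points vanish and
  -- the value 0 is harmless.
  let t : W → L := fun w => if hw : ∃ i, c i = w ∧ X (Sum.inl i) ∉ q then
    g (X (Sum.inr hw.choose)) / g (X (Sum.inl hw.choose)) else 0
  refine (coloredIdeal_le_ker g t (fun i hi => (hg _).2 (hS i hi)) fun i => ?_).trans
    fun f hf => (hg f).1 hf
  by_cases hi : X (Sum.inl i) ∈ q
  · rw [(hg _).2 hi, (hg _).2 (hxy i hi), zero_mul]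
  · have hw : ∃ j, c j = c i ∧ X (Sum.inl j) ∉ q := ⟨i, rfl, hi⟩
    have hj := hw.choose_spec
    have h0 := (hg _).2 (h _ _ hj.2 hi hj.1)
    rw [edgeBinomial, map_sub, map_mul, map_mul] at h0
    have hne : g (X (Sum.inl hw.choose)) ≠ 0 := fun h => hj.2 ((hg _).1 h)
    simp only [t, dif_pos hw]
    rw [mul_div_assoc', eq_div_iff hne]
    linear_combination h0

theorem coloredIdeal_mono {W' : Type*} {S S' : Set V} {c : V → W} {c' : V → W'} (hS : S ⊆ S')
    (h : ∀ i j, i ∉ S' → j ∉ S' → c i = c j → c' i = c' j) :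
    coloredIdeal K S c ≤ coloredIdeal K S' c' :=
  coloredIdeal_le_of_isPrime (fun _ hi => X_inl_mem_coloredIdeal.2 (hS hi))
    (fun _ hi => X_inr_mem_coloredIdeal.2 (X_inl_mem_coloredIdeal.1 hi))
    (fun _ _ _ _ hc => edgeBinomial_mem_coloredIdeal.2 fun hi' hj' => h _ _ hi' hj' hc)

variable {G : SimpleGraph V}

theorem edgeBinomial_mem_binomialEdgeIdeal {i j : V} (h : G.Adj i j) :
    edgeBinomial K i j ∈ G.binomialEdgeIdeal K :=
  Ideal.subset_span ⟨i, j, h, rfl⟩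

theorem binomialEdgeIdeal_le_coloredIdeal {S : Set V} {c : V → W}
    (h : ∀ i j, G.Adj i j → i ∉ S → j ∉ S → c i = c j) :
    G.binomialEdgeIdeal K ≤ coloredIdeal K S c := by
  refine Ideal.span_le.2 ?_
  rintro _ ⟨i, j, hij, rfl⟩
  exact edgeBinomial_mem_coloredIdeal.2 (h i j hij)

theorem edgeBinomial_self (i : V) : edgeBinomial K i i = 0 := sub_self _

/-- Proportionality is transitive through a point with nonzero x-coordinate, by a three-term
relation between minors. -/
theorem edgeBinomial_mem_trans {q : Ideal (MvPolynomial (V ⊕ V) K)} [hq : q.IsPrime] {i j k : V}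
    (hj : X (Sum.inl j) ∉ q) (hij : edgeBinomial K i j ∈ q) (hjk : edgeBinomial K j k ∈ q) :
    edgeBinomial K i k ∈ q := by
  refine (hq.mem_or_mem (?_ : X (Sum.inl j) * edgeBinomial K i k ∈ q)).resolve_left hj
  have : X (Sum.inl j) * edgeBinomial K i k =
      X (Sum.inl i) * edgeBinomial K j k + X (Sum.inl k) * edgeBinomial K i j := by
    simp only [edgeBinomial]; ring
  rw [this]
  exact q.add_mem (q.mul_mem_left _ hjk) (q.mul_mem_left _ hij)

theorem edgeBinomial_mem_of_reachable {q : Ideal (MvPolynomial (V ⊕ V) K)} [q.IsPrime]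
    (hJ : G.binomialEdgeIdeal K ≤ q) {U : Set V} (hU : ∀ i ∈ U, X (Sum.inl i) ∉ q) {i j : V}
    (hi : i ∈ U) (hj : j ∈ U) (h : (G.induce U).Reachable ⟨i, hi⟩ ⟨j, hj⟩) :
    edgeBinomial K i j ∈ q := by
  suffices ∀ u v : U, (G.induce U).Reachable u v → edgeBinomial K (u : V) v ∈ q from
    this ⟨i, hi⟩ ⟨j, hj⟩ h
  rintro u v ⟨w⟩
  induction w with
  | nil => rw [edgeBinomial_self]; exact q.zero_mem
  | @cons u v w huv _ ih =>
    exact edgeBinomial_mem_trans (hU v v.2) (hJ (edgeBinomial_mem_binomialEdgeIdeal huv)) ih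

/-- A smaller prime contains no x_i, so edge minors propagate along walks to whole components. -/
theorem coloredIdeal_connectedComponentMk_mem_minimalPrimes :
    coloredIdeal K (∅ : Set V) G.connectedComponentMk ∈ (G.binomialEdgeIdeal K).minimalPrimes := by
  refine ⟨⟨inferInstance, binomialEdgeIdeal_le_coloredIdeal fun i j h _ _ =>
    ConnectedComponent.sound h.reachable⟩, fun q ⟨hq, hJ⟩ hle => ?_⟩
  have hx : ∀ i, X (Sum.inl i) ∉ q := fun i hi => X_inl_mem_coloredIdeal.1 (hle hi)
  refine coloredIdeal_le_of_isPrime (by simp) (fun i hi => (hx i hi).elim) fun i j _ _ hij => ?_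
  obtain ⟨w⟩ := ConnectedComponent.exact hij
  induction w with
  | nil => rw [edgeBinomial_self]; exact q.zero_mem
  | @cons u v w huv _ ih =>
    refine edgeBinomial_mem_trans (hx v) (hJ (edgeBinomial_mem_binomialEdgeIdeal huv))
      (ih (hx _) (hx _) ?_)
    rw [← hij]
    exact (ConnectedComponent.sound huv.reachable).symm

/-! ### The two inequalities for vertex sets -/

/-- If deleting `S` from a connected component splits it into at least `d + 1` pieces (labelled
by `lab`), then `d ≤ |S|`. -/
theorem label_le_card_of_isCohenMacaulayRing
    (hCM : IsCohenMacaulayRing (MvPolynomial (V ⊕ V) K ⧸ G.binomialEdgeIdeal K))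
    (C : G.ConnectedComponent) (S : Finset V) (hSC : ∀ i ∈ S, G.connectedComponentMk i = C)
    (lab : V → ℕ) (hlab : ∀ i j, G.Adj i j → i ∉ S → j ∉ S → lab i = lab j) (d : ℕ)
    (hd : ∀ m ≤ d, ∃ i ∉ S, G.connectedComponentMk i = C ∧ lab i = m) : d ≤ S.card := by
  classical
  -- At stage m all labels up to m are merged; passing to m + 1 identifies labels m and m + 1,
  -- making the chain strict.
  let c : ℕ → V → G.ConnectedComponent × ℕ := fun m i => (G.connectedComponentMk i, max m (lab i))
  have hmin := coloredIdeal_connectedComponentMk_mem_minimalPrimes (K := K) (G := G)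
  have hp : coloredIdeal K (S : Set V) G.connectedComponentMk ∈
      (coloredIdeal K (∅ : Set V) G.connectedComponentMk ⊔
        Ideal.span ((S.image fun i => (X (Sum.inl i) : MvPolynomial (V ⊕ V) K) : Finset _) :
          Set (MvPolynomial (V ⊕ V) K))).minimalPrimes := by
    refine ⟨⟨inferInstance, sup_le (coloredIdeal_mono (by simp) fun _ _ _ _ h => h)
      (Ideal.span_le.2 fun f hf => ?_)⟩, fun q ⟨hq, hle⟩ hqp => ?_⟩
    · obtain ⟨i, hi, rfl⟩ := Finset.mem_image.1 (Finset.mem_coe.1 hf)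
      exact X_inl_mem_coloredIdeal.2 hi
    · have hPq := le_sup_left.trans hle
      have hrel : ∀ i j, G.connectedComponentMk i = G.connectedComponentMk j →
          edgeBinomial K i j ∈ q := fun i j h =>
        hPq (edgeBinomial_mem_coloredIdeal.2 fun _ _ => h)
      refine coloredIdeal_le_of_isPrime (fun i hi => hle (Ideal.mem_sup_right (Ideal.subset_span
        (Finset.mem_coe.2 (Finset.mem_image_of_mem _ hi))))) (fun i hi => ?_) (fun i j _ _ h => hrel i j h)
      have hiS : i ∈ S := X_inl_mem_coloredIdeal.1 (hqp hi)
      -- A vertex j of the component with x_j ∉ q: the minor on j and i then forces y_i into q.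
      obtain ⟨j, hjS, hjC, -⟩ := hd 0 (Nat.zero_le _)
      have hj : X (Sum.inl j) ∉ q := fun h => hjS (X_inl_mem_coloredIdeal.1 (hqp h))
      refine (hq.mem_or_mem (?_ : X (Sum.inl j) * X (Sum.inr i) ∈ q)).resolve_left hj
      have := hrel j i (hjC.trans (hSC i hiS).symm)
      rw [edgeBinomial] at this
      exact (Submodule.sub_mem_iff_left q (q.mul_mem_right _ hi)).1 this
  refine (hCM.chain_length_le_card hmin _ hp d (fun m => coloredIdeal K (S : Set V) (c m))
    (fun m _ => inferInstance) (fun m _ => ?_) (fun m _ => ?_) (fun m hm => ?_)).trans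
    Finset.card_image_le
  · exact binomialEdgeIdeal_le_coloredIdeal fun i j h hi hj =>
      Prod.ext (ConnectedComponent.sound h.reachable) (congrArg (max m) (hlab i j h hi hj))
  · exact coloredIdeal_mono subset_rfl fun i j _ _ h => congrArg Prod.fst h
  · refine lt_of_le_not_ge (coloredIdeal_mono subset_rfl fun i j _ _ h => ?_) fun hle => ?_
    · simp only [c, Prod.mk.injEq] at h ⊢
      exact ⟨h.1, by omega⟩
    · obtain ⟨i, hi, hiC, him⟩ := hd m hm.le
      obtain ⟨j, hj, hjC, hjm⟩ := hd (m + 1) hm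
      have h1 : edgeBinomial K i j ∈ coloredIdeal K (S : Set V) (c (m + 1)) :=
        edgeBinomial_mem_coloredIdeal.2 fun _ _ => Prod.ext (hiC.trans hjC.symm) (by
          simp [c, him, hjm])
      have h2 := congrArg Prod.snd (edgeBinomial_mem_coloredIdeal.1 (hle h1) hi hj)
      simp only [c] at h2
      omega

/-- If `S` is a minimal separator of a connected component, then `|S| ≤ 1`. -/
theorem card_le_one_of_isCohenMacaulayRing
    (hCM : IsCohenMacaulayRing (MvPolynomial (V ⊕ V) K ⧸ G.binomialEdgeIdeal K))
    (C : G.ConnectedComponent) (S : Finset V) (hnb : ∀ i ∈ S, ∃ j ∉ S, G.Adj i j)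
    (hT : ∀ T ⊂ S, ∀ (i j : V) (hi : i ∉ T) (hj : j ∉ T),
      G.connectedComponentMk i = G.connectedComponentMk j →
        (G.induce ((T : Set V)ᶜ)).Reachable ⟨i, hi⟩ ⟨j, hj⟩)
    (lab : V → ℕ) (hlab : ∀ i j, G.Adj i j → i ∉ S → j ∉ S → lab i = lab j)
    (hS : ∀ (i j : V) (hi : i ∉ S) (hj : j ∉ S),
      G.connectedComponentMk i = G.connectedComponentMk j → lab i = lab j →
        (G.induce ((S : Set V)ᶜ)).Reachable ⟨i, hi⟩ ⟨j, hj⟩)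
    (h01 : ∃ i ∉ S, ∃ j ∉ S, G.connectedComponentMk i = C ∧ G.connectedComponentMk j = C ∧
      lab i ≠ lab j) : S.card ≤ 1 := by
  classical
  let c : V → G.ConnectedComponent × ℕ := fun i => (G.connectedComponentMk i, lab i)
  let P := coloredIdeal K (∅ : Set V) G.connectedComponentMk
  let P' := coloredIdeal K (S : Set V) c
  let p := coloredIdeal K (S : Set V) G.connectedComponentMk
  have hP : P ∈ (G.binomialEdgeIdeal K).minimalPrimes :=
    coloredIdeal_connectedComponentMk_mem_minimalPrimes
  have hPp : P ≤ p := coloredIdeal_mono (by simp) fun _ _ _ _ h => h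
  have hPp' : P' ≤ p := coloredIdeal_mono subset_rfl fun _ _ _ _ h => congrArg Prod.fst h
  have hor : ∀ q : Ideal (MvPolynomial (V ⊕ V) K), q.IsPrime → G.binomialEdgeIdeal K ≤ q → q ≤ p →
      P ≤ q ∨ P' ≤ q := by
    intro q hq hJ hqp
    have hxS : ∀ i, X (Sum.inl i) ∈ q → i ∈ S := fun i hi => X_inl_mem_coloredIdeal.1 (hqp hi)
    have hxy : ∀ i, X (Sum.inl i) ∈ q → X (Sum.inr i) ∈ q := by
      intro i hi
      obtain ⟨j, hj, hij⟩ := hnb i (hxS i hi)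
      refine (hq.mem_or_mem (?_ : X (Sum.inl j) * X (Sum.inr i) ∈ q)).resolve_left
        fun h => hj (hxS j h)
      have := hJ (edgeBinomial_mem_binomialEdgeIdeal (K := K) hij.symm)
      rw [edgeBinomial] at this
      exact (Submodule.sub_mem_iff_left q (q.mul_mem_right _ hi)).1 this
    -- If only a proper subset T of `S` vanishes in q, deleting T does not disconnect any component,
    -- so q contains P.
    by_cases hall : ∀ i ∈ S, X (Sum.inl i) ∈ q
    · right
      refine coloredIdeal_le_of_isPrime hall hxy fun i j hi hj hij => ?_
      have hi' : i ∉ S := fun h => hi (hall i h)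
      have hj' : j ∉ S := fun h => hj (hall j h)
      exact edgeBinomial_mem_of_reachable hJ (U := (S : Set V)ᶜ) (fun k hk h => hk (hxS k h)) hi' hj'
        (hS i j hi' hj' (congrArg Prod.fst hij) (congrArg Prod.snd hij))
    · left
      let T := S.filter fun i => X (Sum.inl i) ∈ q
      have hTS : T ⊂ S := Finset.filter_ssubset.2 (by simpa using hall)
      refine coloredIdeal_le_of_isPrime (by simp) hxy fun i j hi hj hij => ?_
      have hi' : i ∉ T := fun h => hi (Finset.mem_filter.1 h).2
      have hj' : j ∉ T := fun h => hj (Finset.mem_filter.1 h).2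
      exact edgeBinomial_mem_of_reachable hJ (U := (T : Set V)ᶜ)
        (fun k hk h => hk (Finset.mem_filter.2 ⟨hxS k h, h⟩)) hi' hj' (hT T hTS i j hi' hj' hij)
  have hP' : P' ∈ (G.binomialEdgeIdeal K).minimalPrimes := by
    refine ⟨⟨inferInstance, binomialEdgeIdeal_le_coloredIdeal fun i j h hi hj =>
      Prod.ext (ConnectedComponent.sound h.reachable) (hlab i j h hi hj)⟩, fun q ⟨hq, hJ⟩ hle => ?_⟩
    refine (hor q hq hJ (hle.trans hPp')).resolve_left fun h => ?_
    obtain ⟨i, hi, j, hj, hiC, hjC, hne⟩ := h01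
    have h1 : edgeBinomial K i j ∈ P :=
      edgeBinomial_mem_coloredIdeal.2 fun _ _ => hiC.trans hjC.symm
    exact hne (congrArg Prod.snd (edgeBinomial_mem_coloredIdeal.1 (hle (h h1)) hi hj))
  -- The first m vertices of `S` in a fixed enumeration.
  let T : ℕ → Set V := fun m => {i | ∃ h : i ∈ S, (S.equivFin ⟨i, h⟩ : ℕ) < m}
  refine hCM.chain_length_le_one hP hP' hPp hPp' hor (fun q hq hqp h h' => ?_) S.card
    (fun m => coloredIdeal K (T m) G.connectedComponentMk)
    (fun m _ => inferInstance) (fun m _ => ?_) (fun m _ => ?_) (fun m hm => ?_)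
  · refine coloredIdeal_le_of_isPrime (fun i hi => h' (X_inl_mem_coloredIdeal.2 hi))
      (fun i hi => h' (X_inr_mem_coloredIdeal.2 (X_inl_mem_coloredIdeal.1 (hqp hi))))
      (fun i j _ _ hij => h (edgeBinomial_mem_coloredIdeal.2 fun _ _ => hij))
  · exact binomialEdgeIdeal_le_coloredIdeal fun i j h _ _ => ConnectedComponent.sound h.reachable
  · exact coloredIdeal_mono (fun i ⟨hi, _⟩ => hi) fun _ _ _ _ h => h
  · refine lt_of_le_not_ge
      (coloredIdeal_mono (fun i ⟨hi, h⟩ => ⟨hi, by omega⟩) fun _ _ _ _ h => h) fun hle => ?_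
    let i := S.equivFin.symm ⟨m, hm⟩
    have hi : (i : V) ∈ T (m + 1) := ⟨i.2, by simp [i]⟩
    obtain ⟨_, h⟩ := X_inl_mem_coloredIdeal.1 (hle (X_inl_mem_coloredIdeal.2 hi))
    simp [i] at h

end SimpleGraph

/-! ### Separators of a component, seen in the whole graph -/

namespace SimpleGraph

variable {V : Type*} {G : SimpleGraph V}

theorem preconnected_of_numComponentsDelete_lt_two [Finite V] {S : Finset V}
    (h : G.numComponentsDelete S < 2) : (G.induce ((S : Set V)ᶜ)).Preconnected := by
  have : Subsingleton (G.induce ((S : Set V)ᶜ)).ConnectedComponent :=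
    Finite.card_le_one_iff_subsingleton.1 (Nat.lt_succ_iff.1 h)
  exact fun u v => ConnectedComponent.exact (Subsingleton.elim _ _)

theorem Reachable.exists_adj {u v : V} (h : G.Reachable u v) (hne : u ≠ v) : ∃ w, G.Adj u w := by
  obtain ⟨p⟩ := h
  cases p with
  | nil => exact (hne rfl).elim
  | cons h _ => exact ⟨_, h⟩

/-- Delete everything except two nonadjacent vertices. -/
theorem exists_two_le_numComponentsDelete [Finite V] (hG : G ≠ ⊤) :
    ∃ S : Finset V, 2 ≤ G.numComponentsDelete S := by
  classical
  have := Fintype.ofFinite V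
  obtain ⟨u, v, huv, hadj⟩ : ∃ u v, u ≠ v ∧ ¬ G.Adj u v := by
    by_contra! h
    exact hG (eq_top_iff.2 fun u v huv => h u v huv)
  refine ⟨({u, v} : Finset V)ᶜ, not_lt.1 fun h => ?_⟩
  have hmem : ∀ w, w ∈ ((({u, v} : Finset V)ᶜ : Finset V) : Set V)ᶜ ↔ w = u ∨ w = v := fun w => by
    rw [Set.mem_compl_iff, Finset.mem_coe, Finset.mem_compl, not_not, Finset.mem_insert,
      Finset.mem_singleton]
  obtain ⟨⟨w, hw⟩, hadj'⟩ := (preconnected_of_numComponentsDelete_lt_two h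
    ⟨u, (hmem u).2 (Or.inl rfl)⟩ ⟨v, (hmem v).2 (Or.inr rfl)⟩).exists_adj (by simpa using huv)
  have hadj'' : G.Adj u w := hadj'
  rcases (hmem w).1 hw with rfl | rfl
  · exact G.irrefl hadj''
  · exact hadj hadj''

theorem exists_mem_compl_of_two_le_numComponentsDelete [Finite V] {S : Finset V}
    (h : 2 ≤ G.numComponentsDelete S) (i : V) : ∃ j ∉ S, j ≠ i := by
  by_contra! hcon
  have : Subsingleton (((S : Set V)ᶜ : Set V)) :=
    ⟨fun a b => Subtype.ext ((hcon a a.2).trans (hcon b b.2).symm)⟩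
  have : Subsingleton (G.induce ((S : Set V)ᶜ)).ConnectedComponent :=
    ⟨fun a b => by
      induction a using ConnectedComponent.ind
      induction b using ConnectedComponent.ind
      exact congrArg _ (Subsingleton.elim _ _)⟩
  have := Finite.card_le_one_iff_subsingleton.2 this
  unfold numComponentsDelete at h
  omega

namespace ConnectedComponent

variable (C : G.ConnectedComponent) (S : Finset C)

open Classical in
/-- A numbering of the connected components of `C \ S`, extended by `0`. -/
def deleteLabel [Finite V] (i : V) : ℕ :=
  if h : ∃ hi : i ∈ C, (⟨i, hi⟩ : C) ∈ ((S : Set C)ᶜ) then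
    Finite.equivFin _ ((C.toSimpleGraph.induce ((S : Set C)ᶜ)).connectedComponentMk
      ⟨⟨i, h.choose⟩, h.choose_spec⟩)
  else 0

/-- A set of vertices of a component, as a set of vertices of the graph. -/
def liftFinset : Finset V := S.map (Function.Embedding.subtype _)

variable {C S}

theorem mem_liftFinset {i : V} : i ∈ C.liftFinset S ↔ ∃ hi : i ∈ C, (⟨i, hi⟩ : C) ∈ S := by
  simp only [liftFinset, Finset.mem_map, Function.Embedding.subtype_apply]
  exact ⟨fun ⟨a, ha, h⟩ => h ▸ ⟨a.2, ha⟩, fun ⟨hi, h⟩ => ⟨_, h, rfl⟩⟩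

theorem card_liftFinset : (C.liftFinset S).card = S.card := Finset.card_map _

theorem deleteLabel_of_mem [Finite V] {i : V} (hi : i ∈ C) (h : (⟨i, hi⟩ : C) ∈ ((S : Set C)ᶜ)) :
    C.deleteLabel S i = Finite.equivFin _
      ((C.toSimpleGraph.induce ((S : Set C)ᶜ)).connectedComponentMk ⟨⟨i, hi⟩, h⟩) := by
  have h' : ∃ hi : i ∈ C, (⟨i, hi⟩ : C) ∈ ((S : Set C)ᶜ) := ⟨hi, h⟩
  rw [deleteLabel, dif_pos h']

theorem deleteLabel_eq_iff [Finite V] {i j : V} (hi : i ∈ C) (hiS : (⟨i, hi⟩ : C) ∈ ((S : Set C)ᶜ))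
    (hj : j ∈ C) (hjS : (⟨j, hj⟩ : C) ∈ ((S : Set C)ᶜ)) :
    C.deleteLabel S i = C.deleteLabel S j ↔
      (C.toSimpleGraph.induce ((S : Set C)ᶜ)).Reachable ⟨⟨i, hi⟩, hiS⟩ ⟨⟨j, hj⟩, hjS⟩ := by
  rw [deleteLabel_of_mem hi hiS, deleteLabel_of_mem hj hjS, Fin.val_inj, EmbeddingLike.apply_eq_iff_eq,
    ConnectedComponent.eq]

theorem deleteLabel_eq_of_adj [Finite V] {i j : V} (hij : G.Adj i j) (hi : i ∉ C.liftFinset S)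
    (hj : j ∉ C.liftFinset S) : C.deleteLabel S i = C.deleteLabel S j := by
  by_cases hiC : i ∈ C
  · have hjC : j ∈ C := (C.mem_supp_congr_adj hij).1 hiC
    refine (deleteLabel_eq_iff hiC (fun h => hi (mem_liftFinset.2 ⟨hiC, h⟩)) hjC
      (fun h => hj (mem_liftFinset.2 ⟨hjC, h⟩))).2 (Adj.reachable ?_)
    exact hij
  · have hjC : j ∉ C := fun h => hiC ((C.mem_supp_congr_adj hij).2 h)
    rw [deleteLabel, deleteLabel, dif_neg fun h => hiC h.1, dif_neg fun h => hjC h.1]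

theorem exists_deleteLabel_eq [Finite V] {m : ℕ} (hm : m < C.toSimpleGraph.numComponentsDelete S) :
    ∃ i ∉ C.liftFinset S, G.connectedComponentMk i = C ∧ C.deleteLabel S i = m := by
  obtain ⟨D, hD⟩ := (Finite.equivFin
    (C.toSimpleGraph.induce ((S : Set C)ᶜ)).ConnectedComponent).surjective ⟨m, hm⟩
  induction D using ConnectedComponent.ind with | h v =>
  obtain ⟨⟨v, hv⟩, hvS⟩ := v
  refine ⟨v, fun h => hvS (mem_liftFinset.1 h).2, hv, ?_⟩
  rw [deleteLabel_of_mem hv hvS, hD]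

theorem reachable_induce_of_toSimpleGraph {T : Finset V} {T' : Finset C}
    (hT : ∀ i (hi : i ∈ C), i ∈ T → ⟨i, hi⟩ ∈ T') {i j : V} (hi : i ∉ T) (hj : j ∉ T)
    (hiC : i ∈ C) (hjC : j ∈ C) (hi' : (⟨i, hiC⟩ : C) ∈ ((T' : Set C)ᶜ))
    (hj' : (⟨j, hjC⟩ : C) ∈ ((T' : Set C)ᶜ))
    (h : (C.toSimpleGraph.induce ((T' : Set C)ᶜ)).Reachable ⟨⟨i, hiC⟩, hi'⟩ ⟨⟨j, hjC⟩, hj'⟩) :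
    (G.induce ((T : Set V)ᶜ)).Reachable ⟨i, hi⟩ ⟨j, hj⟩ := by
  let f : C.toSimpleGraph.induce ((T' : Set C)ᶜ) →g G.induce ((T : Set V)ᶜ) :=
    { toFun := fun v => ⟨v.1.1, fun hv => v.2 (hT _ v.1.2 hv)⟩
      map_rel' := fun {a b} hab => hab }
  exact h.map f

theorem reachable_induce_of_notMem {T : Finset V} (hT : ∀ i ∈ T, i ∈ C) {i j : V}
    (hi : i ∉ T) (hj : j ∉ T) (hiC : i ∉ C)
    (hij : G.connectedComponentMk i = G.connectedComponentMk j) :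
    (G.induce ((T : Set V)ᶜ)).Reachable ⟨i, hi⟩ ⟨j, hj⟩ := by
  have h := (G.connectedComponentMk i).reachable_toSimpleGraph (u := i) (v := j) rfl hij.symm
  let f : (G.connectedComponentMk i).toSimpleGraph →g G.induce ((T : Set V)ᶜ) :=
    { toFun := fun v => ⟨v.1, fun hv => hiC (by
        have h1 : G.connectedComponentMk v.1 = C := hT _ hv
        have h2 : G.connectedComponentMk v.1 = G.connectedComponentMk i := v.2
        exact h2.symm.trans h1)⟩
      map_rel' := fun {a b} hab => hab }
  exact h.map f

variable {K : Type*} [Field K]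

theorem numComponentsDelete_le_card_add_one [Finite V]
    (hCM : IsCohenMacaulayRing (MvPolynomial (V ⊕ V) K ⧸ G.binomialEdgeIdeal K))
    (hS : 2 ≤ C.toSimpleGraph.numComponentsDelete S) :
    C.toSimpleGraph.numComponentsDelete S ≤ S.card + 1 := by
  have := label_le_card_of_isCohenMacaulayRing hCM C (C.liftFinset S)
    (fun i hi => (mem_liftFinset.1 hi).1) (C.deleteLabel S)
    (fun i j hij hi hj => deleteLabel_eq_of_adj hij hi hj)
    (C.toSimpleGraph.numComponentsDelete S - 1)
    (fun m hm => exists_deleteLabel_eq (by omega))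
  rw [card_liftFinset] at this
  omega

theorem card_le_one_of_minimal [Finite V]
    (hCM : IsCohenMacaulayRing (MvPolynomial (V ⊕ V) K ⧸ G.binomialEdgeIdeal K))
    (hS : 2 ≤ C.toSimpleGraph.numComponentsDelete S)
    (hmin : ∀ T : Finset C, T.card < S.card → C.toSimpleGraph.numComponentsDelete T < 2) :
    S.card ≤ 1 := by
  classical
  have := card_le_one_of_isCohenMacaulayRing hCM C (C.liftFinset S) ?_ ?_ (C.deleteLabel S)
    (fun i j hij hi hj => deleteLabel_eq_of_adj hij hi hj) ?_ ?_
  · rwa [card_liftFinset] at this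
  · intro i hi
    obtain ⟨hiC, hiS⟩ := mem_liftFinset.1 hi
    -- Returning i to C \ S gives a connected graph with another vertex j, so i has a neighbor
    -- outside `S`.
    obtain ⟨j, hj, hji⟩ := exists_mem_compl_of_two_le_numComponentsDelete hS ⟨i, hiC⟩
    have hpre := preconnected_of_numComponentsDelete_lt_two
      (hmin (S.erase ⟨i, hiC⟩) (Finset.card_erase_lt_of_mem hiS))
    have hi' : (⟨i, hiC⟩ : C) ∈ ((S.erase ⟨i, hiC⟩ : Finset C) : Set C)ᶜ := by simp
    have hj' : j ∈ ((S.erase ⟨i, hiC⟩ : Finset C) : Set C)ᶜ := by simp [hj]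
    obtain ⟨⟨w, hw⟩, hadj⟩ := (hpre ⟨_, hi'⟩ ⟨j, hj'⟩).exists_adj
      (fun h => hji (congrArg Subtype.val h).symm)
    have hadj' : G.Adj i w.1 := hadj
    refine ⟨w.1, fun hwS => hw ?_, hadj'⟩
    exact Finset.mem_coe.2 (Finset.mem_erase.2
      ⟨fun h => hadj'.ne (congrArg Subtype.val h).symm, (mem_liftFinset.1 hwS).2⟩)
  · intro T hT i j hi hj hij
    by_cases hiC : i ∈ C
    · have hjC : j ∈ C := hij.symm.trans hiC
      let T' : Finset C := S.filter fun v => v.1 ∈ T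
      have hT' : T'.card < S.card := by
        rw [← card_liftFinset (S := T'), ← card_liftFinset (S := S)]
        refine Finset.card_lt_card (lt_of_le_of_lt (fun v hv => ?_) hT)
        exact (Finset.mem_filter.1 (mem_liftFinset.1 hv).2).2
      exact reachable_induce_of_toSimpleGraph (T' := T')
        (fun v hv h => Finset.mem_filter.2 ⟨(mem_liftFinset.1 (hT.1 h)).2, h⟩) hi hj hiC hjC
        (fun h => hi (Finset.mem_filter.1 h).2) (fun h => hj (Finset.mem_filter.1 h).2)
        (preconnected_of_numComponentsDelete_lt_two (hmin T' hT') _ _)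
    · exact reachable_induce_of_notMem
        (fun v hv => (mem_liftFinset.1 (hT.1 hv)).1) hi hj hiC hij
  · intro i j hi hj hij hlab
    by_cases hiC : i ∈ C
    · have hjC : j ∈ C := hij.symm.trans hiC
      exact reachable_induce_of_toSimpleGraph (T' := S)
        (fun v hv h => (mem_liftFinset.1 h).2) hi hj hiC hjC _ _
        ((deleteLabel_eq_iff hiC (fun h => hi (mem_liftFinset.2 ⟨hiC, h⟩)) hjC
          (fun h => hj (mem_liftFinset.2 ⟨hjC, h⟩))).1 hlab)
    · exact reachable_induce_of_notMem (fun v hv => (mem_liftFinset.1 hv).1) hi hj hiC hij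
  · obtain ⟨i, hi, hiC, h0⟩ := exists_deleteLabel_eq (C := C) (S := S) (m := 0) (by omega)
    obtain ⟨j, hj, hjC, h1⟩ := exists_deleteLabel_eq (C := C) (S := S) (m := 1) (by omega)
    exact ⟨i, hi, j, hj, hiC, hjC, by omega⟩

end ConnectedComponent

/-! ### Toughness one half -/

theorem toughness_eq_half (hG : G.Connected)
    (h : ∀ S : Finset V, 2 ≤ G.numComponentsDelete S → G.numComponentsDelete S ≤ S.card + 1)
    (S : Finset V) (hS : 2 ≤ G.numComponentsDelete S) (hS1 : S.card = 1) :
    G.toughness = 1 / 2 := by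
  refine le_antisymm (iSup₂_le fun t ht => ?_) ?_
  · have h1 := ht.2 S (Finset.card_pos.1 (by omega)) hS
    have h2 : (2 : ℝ≥0) ≤ G.numComponentsDelete S := by exact_mod_cast hS
    rw [hS1, Nat.cast_one] at h1
    have h3 : t * 2 ≤ 1 := (mul_le_mul_right h2 t).trans h1
    rw [ENNReal.le_div_iff_mul_le (by simp) (by simp)]
    exact_mod_cast h3
  · have htough : G.IsTough (1 / 2) := by
      refine ⟨hG, fun T hT hT2 => ?_⟩
      have h1 := h T hT2
      have h2 := Finset.card_pos.2 hT
      have h3 : (G.numComponentsDelete T : ℝ≥0) ≤ 2 * T.card := by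
        exact_mod_cast (by omega : G.numComponentsDelete T ≤ 2 * T.card)
      calc (1 / 2 : ℝ≥0) * G.numComponentsDelete T ≤ 1 / 2 * (2 * T.card) := by gcongr
        _ = T.card := by rw [← mul_assoc]; norm_num
    have := le_iSup₂ (f := fun (t : ℝ≥0) (_ : G.IsTough t) => (t : ℝ≥0∞)) (1 / 2) htough
    refine le_trans (le_of_eq ?_) this
    rw [ENNReal.coe_div (by simp)]
    simp

end SimpleGraph

end

theorem mainTheorem9 {K : Type*} [Field K] (n : ℕ) (G : SimpleGraph (Fin n))
    (hCM : IsCohenMacaulayRing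
      (MvPolynomial (Fin n ⊕ Fin n) K ⧸ G.binomialEdgeIdeal K))
    (C : G.ConnectedComponent) :
    C.toSimpleGraph = ⊤ ∨ C.toSimpleGraph.toughness = 1 / 2 := by
  classical
  refine or_iff_not_imp_left.2 fun hC => ?_
  have hconn := C.connected_toSimpleGraph
  obtain ⟨S, hS, hmin⟩ := exists_minimalFor_of_wellFoundedLT
    (fun S : Finset C => 2 ≤ C.toSimpleGraph.numComponentsDelete S) Finset.card
    (SimpleGraph.exists_two_le_numComponentsDelete hC)
  have hle := SimpleGraph.ConnectedComponent.card_le_one_of_minimal hCM hS fun T hT =>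
    not_le.1 fun h => hT.not_ge (hmin h hT.le)
  refine SimpleGraph.toughness_eq_half hconn (fun T hT =>
    SimpleGraph.ConnectedComponent.numComponentsDelete_le_card_add_one hCM hT) S hS ?_
  -- From 2 ≤ c(S) ≤ |S| + 1 comes |S| ≥ 1, the other half of |S| = 1.
  have := SimpleGraph.ConnectedComponent.numComponentsDelete_le_card_add_one hCM hS
  omega
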